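/- Let $(+,\times)$ be the signature with two binary function symbols; every ring, in particular $\mathbb{Z}$ and every polynomial ring, is regarded as a $(+,\times)$-structure. An $n$-dimensional interpretation $\Gamma$ ($n \ge 1$) of an $\mathcal{L}'$-structure $M'$ in an $\mathcal{L}$-structure $M$ consists of parameter-free first-order $\mathcal{L}$-formulas, namely a domain formula $\partial_\Gamma$ in $n$ variables, defining a set $\Delta_\Gamma \subseteq M^n$, a formula $=_\Gamma$ in $2n$ variables, a formula $Q_\Gamma$ in $mn$ variables for each $m$-ary relation symbol $Q$ of $\mathcal{L}'$, and a formula $G_\Gamma$ in $(m+1)n$ variables for each $m$-ary function symbol $G$ of $\mathcal{L}'$, together with a surjective coordinate map $F_\Gamma : \Delta_\Gamma \to M'$, such that for all $a, b, a_1, \dots, a_m \in \Delta_\Gamma$: $M \models a =_\Gamma b$ iff $F_\Gamma(a) = F_\Gamma(b)$; $M \models Q_\Gamma(a_1, \dots, a_m)$ iff $M' \models Q(F_\Gamma(a_1), \dots, F_\Gamma(a_m))$; and $M \models G_\Gamma(a_1, \dots, a_m, b)$ iff $G(F_\Gamma(a_1), \dots, F_\Gamma(a_m)) = F_\Gamma(b)$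 in $M'$. The interpretation is uniform in a class of structures $M$ if the formulas (but not necessarily the coordinate map) are the same for all members of the class. **Theorem.** There is a two-dimensional interpretation $\Gamma$ of $(\mathbb{Z}^+, \le, \mid)$ that is uniform in the class of polynomial rings $R[x]$ in one variable over fields $R$ of positive characteristic, with formulas that depend neither on $R$ nor on its characteristic, such that for every field $R$ of characteristic $p > 0$ $$\Delta_\Gamma = \{ (\ell, \ell^{p^n}) : \ell \in R[x],\ \deg \ell = 1,\ n \in \mathbb{Z}^+ \}, \qquad F_\Gamma(\ell, \ell^{p^n}) = n .$$ Consequently, arithmetic $(\mathbb{Z}, +, \times)$ is uniformly interpretable in this class of rings, that is, for some $n \ge 1$ there is an $n$-dimensional interpretation of $(\mathbb{Z}, +, \times)$ that is uniform in it. -/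

import Mathlib

open FirstOrder

universe u u₁ v₁ u₂ v₂ w w'

/-- The formulas of an `n`-dimensional interpretation of `L'`-structures in `L`-structures, without
parameters. The variables of a formula in `m` tuples of length `n` are indexed by `Fin m × Fin n`:
the variable `(i, j)` is the `j`-th entry of the `i`-th tuple. -/
structure InterpretationFormulas (n : ℕ) (L' : FirstOrder.Language.{u₁, v₁}) (L : FirstOrder.Language.{u₂, v₂}) where
  /-- the domain formula -/
  domain : L.Formula (Fin n)
  /-- the formula interpreting equality -/
  eq : L.Formula (Fin 2 × Fin n)
  /-- the formula interpreting a relation symbol -/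
  rel : ∀ {m : ℕ}, L'.Relations m → L.Formula (Fin m × Fin n)
  /-- the formula interpreting (the graph of) a function symbol; the last tuple is the value -/
  func : ∀ {m : ℕ}, L'.Functions m → L.Formula (Fin (m + 1) × Fin n)

namespace InterpretationFormulas

variable {n : ℕ} {L' : FirstOrder.Language.{u₁, v₁}} {L : FirstOrder.Language.{u₂, v₂}}

/-- The subset of `M ^ n` defined by the domain formula. -/
def domainSet (Γ : InterpretationFormulas n L' L) (M : Type w) [L.Structure M] :
    Set (Fin n → M) :=
  {a | Γ.domain.Realize a}

/-- A coordinate map which makes the formulas `Γ` an interpretation of the `L'`-structure `M'`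
in the `L`-structure `M`. -/
structure CoordinateMap (Γ : InterpretationFormulas n L' L) (M : Type w) [L.Structure M]
    (M' : Type w') [L'.Structure M'] where
  /-- the coordinate map -/
  toFun : Γ.domainSet M → M'
  surjective : Function.Surjective toFun
  eq_iff : ∀ a b : Γ.domainSet M,
    Γ.eq.Realize (fun ij => (![a.1, b.1] : Fin 2 → Fin n → M) ij.1 ij.2) ↔ toFun a = toFun b
  rel_iff : ∀ {m : ℕ} (Q : L'.Relations m) (a : Fin m → Γ.domainSet M),
    (Γ.rel Q).Realize (fun ij => (a ij.1).1 ij.2) ↔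
      FirstOrder.Language.Structure.RelMap Q (fun i => toFun (a i))
  func_iff : ∀ {m : ℕ} (G : L'.Functions m) (a : Fin m → Γ.domainSet M) (b : Γ.domainSet M),
    (Γ.func G).Realize
        (fun ij => (Fin.snoc (fun i => (a i).1) b.1 : Fin (m + 1) → Fin n → M) ij.1 ij.2) ↔
      FirstOrder.Language.Structure.funMap G (fun i => toFun (a i)) = toFun b

end InterpretationFormulas

/-- The function symbols of the signature `(+, ×)`. -/
inductive AddMulFunc : ℕ → Type
  | add : AddMulFunc 2
  | mul : AddMulFunc 2

/-- The signature `(+, ×)`. -/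
def addMulLanguage : FirstOrder.Language.{0, 0} := ⟨AddMulFunc, fun _ => Empty⟩

/-- Every type with an addition and a multiplication is a `(+, ×)`-structure. -/
instance addMulStructure (S : Type w) [Add S] [Mul S] : addMulLanguage.Structure S where
  funMap {m} (f : AddMulFunc m) :=
    match m, f with
    | _, .add => fun x => x 0 + x 1
    | _, .mul => fun x => x 0 * x 1
  RelMap r := r.elim

/-- The relation symbols of the signature `(≤, ∣)`. -/
inductive LeDvdRel : ℕ → Type
  | le : LeDvdRel 2
  | dvd : LeDvdRel 2

/-- The signature `(≤, ∣)`. -/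
def leDvdLanguage : FirstOrder.Language.{0, 0} := ⟨fun _ => Empty, LeDvdRel⟩

/-- The structure `(ℤ⁺, ≤, ∣)`. -/
instance leDvdStructure : leDvdLanguage.Structure ℕ+ where
  funMap f := f.elim
  RelMap {m} (r : LeDvdRel m) :=
    match m, r with
    | _, .le => fun x => x 0 ≤ x 1
    | _, .dvd => fun x => x 0 ∣ x 1

/-! The exponent `n` is coded by `l ^ p ^ n` with `l` linear. Linear polynomials are definable,
since modulo a nonunit `l` every class contains a constant (zero or a unit) exactly when `l` has
degree one. For linear `l` the powers `l ^ p ^ n` are the nonzero nonunits `f` such that, up to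
units, `f` is a power of `l` and `f - 1` is a power of `l - 1`, normalised by `l - 1 ∣ f - 1`.
Frobenius shows that these powers qualify. Conversely the conditions give `l ^ m - 1` associated to
`(l - 1) ^ m`, and since `1` is a simple root of `y ^ m' - 1` for `m'` prime to `p`, `m` must be a
power of `p` (`eq_pow_of_isPowerLike`). No formula mentions `p`.

Exponents over different bases are compared through affine equivalence, which Frobenius preserves
(`exists_eq_const_mul_add_iff`). Over a common base, order of exponents is divisibility of powers,
and congruence modulo `k` is divisibility by `l ^ p ^ k - l` (`pow_modEq_iff`); divisibility of
exponents is the case of congruence to `0`.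

For arithmetic, addition comes from order and congruence, squaring from least common multiples of
`a` and `a + 1`, and multiplication from squares. Integers are differences of exponents.

The formulas are never written out. `DefinabilitySystem` abstracts the closure properties of
definable relations and is used twice: for polynomial rings, and for positive integers coded by
polynomials. Indexing by all fields of positive characteristic at once yields uniformity. -/

/-- A notion of definability for families of relations on a family of types, closed under the
first-order operations. A relation with variables in `α` is given by its truth value at each
assignment. -/
structure DefinabilitySystem {ι : Type u} (M : ι → Type w) where
  /-- the definable relations -/
  Def : ∀ {α : Type}, (∀ i, (α → M i) → Prop) → Prop
  eq_var : ∀ {α : Type} (a b : α), Def fun _ v => v a = v b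
  not : ∀ {α : Type} {P : ∀ i, (α → M i) → Prop}, Def P → Def fun i v => ¬ P i v
  and : ∀ {α : Type} {P Q : ∀ i, (α → M i) → Prop}, Def P → Def Q → Def fun i v => P i v ∧ Q i v
  ex : ∀ {α : Type} {P : ∀ i, (α → M i) → M i → Prop},
    Def (α := Option α) (fun i w => P i (fun a => w (some a)) (w none)) →
      Def fun i v => ∃ y, P i v y
  relabel : ∀ {α β : Type} {P : ∀ i, (α → M i) → Prop} (g : α → β),
    Def P → Def fun i w => P i fun a => w (g a)

/-! ### Closure properties of definable relations and functions. -/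

namespace DefinabilitySystem

variable {ι : Type u} {M : ι → Type w} (S : DefinabilitySystem M) {α : Type}

/-- A family of functions is definable if its graph is. -/
def Fun (t : ∀ i, (α → M i) → M i) : Prop :=
  S.Def (α := Option α) fun i w => w none = t i fun a => w (some a)

variable {S}

theorem congr {P Q : ∀ i, (α → M i) → Prop} (hP : S.Def P) (h : ∀ i v, P i v ↔ Q i v) :
    S.Def Q := by
  have : P = Q := by
    funext i v
    exact propext (h i v)
  exact this ▸ hP

theorem or {P Q : ∀ i, (α → M i) → Prop} (hP : S.Def P) (hQ : S.Def Q) :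
    S.Def fun i v => P i v ∨ Q i v :=
  congr (S.not (S.and (S.not hP) (S.not hQ))) fun _ _ => by tauto

theorem imp {P Q : ∀ i, (α → M i) → Prop} (hP : S.Def P) (hQ : S.Def Q) :
    S.Def fun i v => P i v → Q i v :=
  congr (S.not (S.and hP (S.not hQ))) fun _ _ => by tauto

theorem all {P : ∀ i, (α → M i) → M i → Prop}
    (hP : S.Def (α := Option α) (fun i w => P i (fun a => w (some a)) (w none))) :
    S.Def fun i v => ∀ y, P i v y :=
  congr (S.not (S.ex (P := fun i v y => ¬ P i v y) (S.not hP))) fun _ _ => by simp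

theorem var (a : α) : S.Fun fun _ v => v a :=
  S.eq_var none (some a)

theorem Fun.wk {t : ∀ i, (α → M i) → M i} (ht : S.Fun t) :
    S.Fun (α := Option α) fun i w => t i fun a => w (some a) :=
  S.relabel (Option.map some) ht

/-- Substitution of a definable function: `P (t v)` is `∃ y, y = t v ∧ P y`, so only graphs are
needed and no terms. -/
theorem bind {P : ∀ i, (α → M i) → M i → Prop} {t : ∀ i, (α → M i) → M i}
    (hP : S.Def (α := Option α) (fun i w => P i (fun a => w (some a)) (w none)))
    (ht : S.Fun t) : S.Def fun i v => P i v (t i v) :=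
  congr (S.ex (P := fun i v y => y = t i v ∧ P i v y) (S.and ht hP)) fun _ _ => by simp

theorem bind₂ {Q : ∀ i, M i → M i → Prop} {s t : ∀ i, (α → M i) → M i}
    (hQ : S.Def (α := Fin 2) fun i v => Q i (v 0) (v 1)) (hs : S.Fun s) (ht : S.Fun t) :
    S.Def fun i v => Q i (s i v) (t i v) :=
  bind (P := fun i v y => Q i y (t i v))
    (bind (P := fun i w z => Q i (w none) z) (S.relabel ![some none, none] hQ) ht.wk) hs

theorem bind₃ {Q : ∀ i, M i → M i → M i → Prop} {r s t : ∀ i, (α → M i) → M i}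
    (hQ : S.Def (α := Fin 3) fun i v => Q i (v 0) (v 1) (v 2)) (hr : S.Fun r) (hs : S.Fun s)
    (ht : S.Fun t) : S.Def fun i v => Q i (r i v) (s i v) (t i v) :=
  bind (P := fun i v y => Q i y (s i v) (t i v))
    (bind (P := fun i w z => Q i (w none) z (t i fun a => w (some a)))
      (bind (P := fun i w z => Q i (w (some none)) (w none) z)
        (S.relabel ![some (some none), some none, none] hQ) ht.wk.wk) hs.wk) hr

theorem comp₂ {f : ∀ i, M i → M i → M i} {s t : ∀ i, (α → M i) → M i}
    (hf : S.Def (α := Fin 3) fun i v => v 0 = f i (v 1) (v 2)) (hs : S.Fun s) (ht : S.Fun t) :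
    S.Fun fun i v => f i (s i v) (t i v) :=
  bind₃ (Q := fun i x y z => x = f i y z) hf (var none) hs.wk ht.wk

theorem eq {s t : ∀ i, (α → M i) → M i} (hs : S.Fun s) (ht : S.Fun t) :
    S.Def fun i v => s i v = t i v :=
  bind₂ (Q := fun _ x y => x = y) (S.eq_var 0 1) hs ht

end DefinabilitySystem

/-! ### Uniform first-order definability in commutative rings. -/

/-- Relations which are defined by one `(+, ×)`-formula in all members of a family of rings. -/
def uniformDefinability {ι : Type u} (M : ι → Type w) [∀ i, CommRing (M i)] :
    DefinabilitySystem M where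
  Def {α} P := ∃ φ : addMulLanguage.Formula α, ∀ i v, φ.Realize v ↔ P i v
  eq_var a b := ⟨(Language.var a).equal (Language.var b), fun i v => by simp [Language.Formula.realize_equal]⟩
  not := fun ⟨φ, h⟩ => ⟨∼φ, fun i v => by simp [h]⟩
  and := fun ⟨φ, h⟩ ⟨ψ, h'⟩ => ⟨φ ⊓ ψ, fun i v => by simp [h, h']⟩
  ex := fun {α P} ⟨φ, h⟩ => ⟨(φ.relabel fun o : Option α => o.elim (Sum.inr ()) Sum.inl).iExs Unit,
    fun i v => by
      simp only [Language.Formula.realize_iExs, Language.Formula.realize_relabel, h]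
      exact ⟨fun ⟨y, hy⟩ => ⟨y (), hy⟩, fun ⟨y, hy⟩ => ⟨fun _ => y, hy⟩⟩⟩
  relabel g := fun ⟨φ, h⟩ => ⟨φ.relabel g, fun i v => by
    simp only [Language.Formula.realize_relabel, h]; rfl⟩

namespace uniformDefinability

open DefinabilitySystem

variable {ι : Type u} {M : ι → Type w} [∀ i, CommRing (M i)] {α : Type}
  {s t : ∀ i, (α → M i) → M i}

theorem add (hs : (uniformDefinability M).Fun s) (ht : (uniformDefinability M).Fun t) :
    (uniformDefinability M).Fun fun i v => s i v + t i v :=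
  comp₂ (f := fun _ x y => x + y)
    ⟨(Language.var 0).equal (Language.Functions.apply₂ (L := addMulLanguage) AddMulFunc.add
      (Language.var 1) (Language.var 2)), fun i v => by
      rw [Language.Formula.realize_equal]; rfl⟩ hs ht

theorem mul (hs : (uniformDefinability M).Fun s) (ht : (uniformDefinability M).Fun t) :
    (uniformDefinability M).Fun fun i v => s i v * t i v :=
  comp₂ (f := fun _ x y => x * y)
    ⟨(Language.var 0).equal (Language.Functions.apply₂ (L := addMulLanguage) AddMulFunc.mul
      (Language.var 1) (Language.var 2)), fun i v => by
      rw [Language.Formula.realize_equal]; rfl⟩ hs ht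

theorem sub (hs : (uniformDefinability M).Fun s) (ht : (uniformDefinability M).Fun t) :
    (uniformDefinability M).Fun fun i v => s i v - t i v :=
  comp₂ (f := fun _ x y => x - y)
    (congr (eq (add (var 0) (var 2)) (var 1)) fun _ _ => eq_sub_iff_add_eq.symm) hs ht

theorem zero : (uniformDefinability M).Fun (α := α) fun _ _ => 0 :=
  congr (eq (add (var none) (var none)) (var none)) fun _ _ => by simp

theorem one : (uniformDefinability M).Fun (α := α) fun _ _ => 1 :=
  congr (all (P := fun _ w y => w none * y = y) (eq (mul (var (some none)) (var none)) (var none)))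
    fun _ w => ⟨fun h => by simpa using h 1, fun h y => by rw [h, one_mul]⟩

theorem dvd (hs : (uniformDefinability M).Fun s) (ht : (uniformDefinability M).Fun t) :
    (uniformDefinability M).Def fun i v => s i v ∣ t i v :=
  congr (DefinabilitySystem.ex _ (P := fun i v y => t i v = s i v * y)
    (eq ht.wk (mul hs.wk (var none)))) fun _ _ => Iff.rfl

theorem isUnit (hs : (uniformDefinability M).Fun s) :
    (uniformDefinability M).Def fun i v => IsUnit (s i v) :=
  congr (dvd hs one) fun _ _ => isUnit_iff_dvd_one.symm

/-- `IsPowerLike q f` says that `f` has no nonunit divisors prime to `q`. -/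
def _root_.IsPowerLike {A : Type w} [CommRing A] (q f : A) : Prop :=
  ∀ d, d ∣ f → IsUnit d ∨ q ∣ d

theorem isPowerLike (hs : (uniformDefinability M).Fun s) (ht : (uniformDefinability M).Fun t) :
    (uniformDefinability M).Def fun i v => IsPowerLike (s i v) (t i v) :=
  all (P := fun i v d => d ∣ t i v → IsUnit d ∨ s i v ∣ d)
    (imp (dvd (var none) ht.wk) (or (isUnit (var none)) (dvd hs.wk (var none))))

end uniformDefinability

/-! ### Powers of linear polynomials in positive characteristic. -/

section Algebra

open Polynomial

variable {R : Type u} [Field R]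

theorem eq_zero_or_isUnit_iff_exists_C {c : R[X]} : (c = 0 ∨ IsUnit c) ↔ ∃ r, c = C r := by
  constructor
  · rintro (rfl | h)
    · exact ⟨0, by simp⟩
    · obtain ⟨r, -, rfl⟩ := Polynomial.isUnit_iff.1 h
      exact ⟨r, rfl⟩
  · rintro ⟨r, rfl⟩
    by_cases hr : r = 0
    · exact Or.inl (by simp [hr])
    · exact Or.inr (Polynomial.isUnit_C.2 (isUnit_iff_ne_zero.2 hr))

/-- For linear `l`, remainders modulo `l` are constants. Conversely, the case `f = X` makes `l` a
nonunit divisor of some irreducible `X - r`, hence associated to it. -/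
theorem degree_eq_one_iff_forall_dvd_sub {l : R[X]} :
    l.degree = 1 ↔ ¬ IsUnit l ∧ ∀ f, ∃ c, (c = 0 ∨ IsUnit c) ∧ l ∣ f - c := by
  constructor
  · intro h
    refine ⟨fun hu => ?_, fun f => ⟨f % l, ?_, ?_⟩⟩
    · rw [Polynomial.degree_eq_zero_of_isUnit hu] at h
      exact absurd h (by decide)
    · have hl : l ≠ 0 := by rintro rfl; simp at h
      have h1 : (f % l).degree < 1 := h ▸ Polynomial.degree_mod_lt f hl
      rw [eq_zero_or_isUnit_iff_exists_C]
      exact ⟨_, Polynomial.eq_C_of_degree_le_zero (Nat.WithBot.lt_one_iff_le_zero.1 h1)⟩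
    · exact ⟨f / l, by rw [sub_eq_iff_eq_add, EuclideanDomain.div_add_mod]⟩
  · rintro ⟨hu, h⟩
    obtain ⟨c, hc, hd⟩ := h X
    obtain ⟨r, rfl⟩ := eq_zero_or_isUnit_iff_exists_C.1 hc
    rcases (Polynomial.irreducible_X_sub_C r).dvd_iff.1 hd with h | h
    · exact absurd h hu
    · rw [← Polynomial.degree_eq_degree_of_associated h, Polynomial.degree_X_sub_C]

/-- After the largest power of `q` is split off from `f`, the cofactor is a divisor of `f` not
divisible by `q`, hence a unit. -/
theorem IsPowerLike.exists_associated_pow {q f : R[X]} (hf : f ≠ 0) (hq : Prime q)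
    (h : IsPowerLike q f) : ∃ k : ℕ, Associated (q ^ k) f := by
  obtain ⟨n, c, hc, rfl⟩ := WfDvdMonoid.max_power_factor hf hq.irreducible
  rcases h c (dvd_mul_left _ _) with h | h
  · exact ⟨n, associated_mul_unit_right _ _ h⟩
  · exact absurd h hc

theorem isPowerLike_pow {q : R[X]} (hq : Prime q) (k : ℕ) : IsPowerLike q (q ^ k) := by
  intro d hd
  obtain ⟨i, -, hi⟩ := (dvd_prime_pow hq k).1 hd
  rcases Nat.eq_zero_or_pos i with rfl | h
  · exact Or.inl (hi.symm.isUnit (by simp))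
  · exact Or.inr ((dvd_pow_self q h.ne').trans hi.symm.dvd)

theorem degree_sub_one_of_degree_eq_one {l : R[X]} (hl : l.degree = 1) : (l - 1).degree = 1 := by
  rw [← hl]
  exact Polynomial.degree_sub_eq_left_of_degree_lt (by rw [hl, Polynomial.degree_one]; decide)

theorem exists_eval_eq_of_degree_eq_one {l : R[X]} (hl : l.degree = 1) (s : R) :
    ∃ r, l.eval r = s := by
  have h : (l - C s).degree = 1 := by
    rw [← hl]
    exact Polynomial.degree_sub_eq_left_of_degree_lt
      (by rw [hl]; exact Polynomial.degree_C_le.trans_lt (by decide))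
  obtain ⟨r, hr⟩ := Polynomial.exists_root_of_degree_eq_one h
  exact ⟨r, by simpa [Polynomial.IsRoot, sub_eq_zero] using hr⟩

theorem derivative_of_degree_eq_one {l : R[X]} (hl : l.degree = 1) :
    ∃ a : R, a ≠ 0 ∧ derivative l = C a := by
  have h := Polynomial.eq_X_add_C_of_degree_le_one hl.le
  refine ⟨l.coeff 1, ?_, by rw [h]; simp⟩
  exact Polynomial.coeff_ne_zero_of_eq_degree hl

/-- If `m` is invertible then `l` is a simple root of `l ^ m - 1`. -/
theorem eq_one_of_sub_one_pow_dvd {l : R[X]} (hl : l.degree = 1) {m : ℕ} (hm : (m : R) ≠ 0)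
    {k : ℕ} (h : (l - 1) ^ k ∣ l ^ m - 1) : k ≤ 1 := by
  by_contra! hk
  obtain ⟨q, hq⟩ := (pow_dvd_pow (l - 1) hk).trans h
  obtain ⟨r, hr⟩ := exists_eval_eq_of_degree_eq_one hl 1
  obtain ⟨a, ha, hla⟩ := derivative_of_degree_eq_one hl
  -- At the root `r` of `l - 1` the derivative of `l ^ m - 1` is `m * a ≠ 0`, while that of a
  -- multiple of `(l - 1) ^ 2` vanishes.
  have := congrArg (fun f => (derivative f).eval r) hq
  simp [Polynomial.derivative_pow, hla, hr, ha, hm] at this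

theorem natDegree_pow_of_degree_eq_one {l : R[X]} (hl : l.degree = 1) (m : ℕ) :
    (l ^ m).natDegree = m := by
  rw [natDegree_pow, show l.natDegree = 1 from natDegree_eq_of_degree_eq_some hl, mul_one]

theorem pow_inj_of_degree_eq_one {l l' : R[X]} (hl : l.degree = 1) (hl' : l'.degree = 1)
    {m n : ℕ} (h : l ^ m = l' ^ n) : m = n := by
  rw [← natDegree_pow_of_degree_eq_one hl m, h, natDegree_pow_of_degree_eq_one hl']

theorem pow_dvd_pow_iff_of_degree_eq_one (hp : p.Prime) {l : R[X]} (hl : l.degree = 1)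
    (m n : ℕ) : l ^ p ^ m ∣ l ^ p ^ n ↔ m ≤ n := by
  have hpl := Polynomial.prime_of_degree_eq_one hl
  rw [pow_dvd_pow_iff hpl.ne_zero hpl.not_isUnit, Nat.pow_le_pow_iff_right hp.one_lt]

variable {p : ℕ} [CharP R p]

theorem eq_pow_of_isPowerLike (hp : p.Prime) {l f : R[X]} (hl : l.degree = 1) (hf0 : f ≠ 0)
    (hfu : ¬ IsUnit f) (hf : IsPowerLike l f) (hf1 : IsPowerLike (l - 1) (f - 1))
    (hd : l - 1 ∣ f - 1) : ∃ k : ℕ, f = l ^ p ^ k := by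
  have : Fact p.Prime := ⟨hp⟩
  have hf1' : f - 1 ≠ 0 := fun h => hfu (by rw [sub_eq_zero.1 h]; exact isUnit_one)
  obtain ⟨m, c, hm⟩ := hf.exists_associated_pow hf0 (Polynomial.prime_of_degree_eq_one hl)
  obtain ⟨k, hk⟩ := hf1.exists_associated_pow hf1'
    (Polynomial.prime_of_degree_eq_one (degree_sub_one_of_degree_eq_one hl))
  obtain ⟨c, hc, hcu⟩ : ∃ r : R, r ≠ 0 ∧ C r = (c : R[X]) := by
    obtain ⟨r, hr, h⟩ := Polynomial.isUnit_iff.1 c.isUnit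
    exact ⟨r, hr.ne_zero, h⟩
  -- `f` is `l ^ m` times a constant; evaluation where `l = 1` makes the constant `1`, because `l -
  -- 1 ∣ f - 1`.
  have hfm : f = l ^ m := by
    obtain ⟨r, hr⟩ := exists_eval_eq_of_degree_eq_one hl 1
    obtain ⟨q, hq⟩ := hd
    have := congrArg (Polynomial.eval r) hq
    rw [← hm, ← hcu] at this
    simp only [eval_sub, eval_mul, eval_pow, hr, eval_C, one_pow, one_mul, eval_one, sub_self,
      zero_mul, sub_eq_zero] at this
    rw [← hm, ← hcu, this, C_1, mul_one]
  have hm0 : m ≠ 0 := by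
    rintro rfl
    exact hfu (by rw [hfm, pow_zero]; exact isUnit_one)
  have hkm : k = m := by
    have h1 := Polynomial.natDegree_eq_of_degree_eq (Polynomial.degree_eq_degree_of_associated hk)
    rwa [hfm, natDegree_pow_of_degree_eq_one (degree_sub_one_of_degree_eq_one hl), ← C_1,
      natDegree_sub_C, natDegree_pow_of_degree_eq_one hl] at h1
  subst hkm
  -- With `m = p ^ n * m'`, both sides of the divisibility are `p ^ n`-th powers by Frobenius.
  -- Taking roots leaves `(l - 1) ^ m' ∣ l ^ m' - 1`, and the simple root forces `m' = 1`.
  obtain ⟨n, m', hm', rfl⟩ := Nat.exists_eq_pow_mul_and_not_dvd hm0 p hp.ne_one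
  have h1 : (l - 1) ^ m' ∣ l ^ m' - 1 := by
    have h2 := hk.dvd
    rw [hfm, mul_comm, pow_mul, pow_mul, ← one_pow (p ^ n), ← sub_pow_char_pow,
      one_pow] at h2
    exact (IsIntegrallyClosed.pow_dvd_pow_iff (pow_ne_zero _ hp.ne_zero)).1 h2
  have h2 := eq_one_of_sub_one_pow_dvd hl (mt (CharP.cast_eq_zero_iff R p m').1 hm') h1
  have h3 : m' = 1 := le_antisymm h2 (Nat.pos_of_ne_zero (right_ne_zero_of_mul hm0))
  exact ⟨n, by rw [hfm, h3, mul_one]⟩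

/-- The condition `f ≠ l` removes the exponent `0`; the right-hand side is first-order in `l` and
`f` and free of `p`. -/
theorem exists_eq_pow_iff (hp : p.Prime) {l f : R[X]} (hl : l.degree = 1) :
    (∃ k : ℕ+, f = l ^ p ^ (k : ℕ)) ↔ f ≠ l ∧ f ≠ 0 ∧ ¬ IsUnit f ∧ IsPowerLike l f ∧
      IsPowerLike (l - 1) (f - 1) ∧ l - 1 ∣ f - 1 := by
  have : Fact p.Prime := ⟨hp⟩
  have hpl := Polynomial.prime_of_degree_eq_one hl
  constructor
  · rintro ⟨k, rfl⟩
    have hs : l ^ p ^ (k : ℕ) - 1 = (l - 1) ^ p ^ (k : ℕ) := by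
      rw [sub_pow_char_pow, one_pow]
    have hk : p ^ (k : ℕ) ≠ 0 := pow_ne_zero _ hp.ne_zero
    refine ⟨fun h => ?_, pow_ne_zero _ hpl.ne_zero, fun h => hpl.not_isUnit ((isUnit_pow_iff hk).1 h),
      isPowerLike_pow hpl _, ?_, ?_⟩
    · have := pow_inj_of_degree_eq_one hl hl (h.trans (pow_one l).symm)
      exact (Nat.one_lt_pow k.ne_zero hp.one_lt).ne' this
    · rw [hs]
      exact isPowerLike_pow (Polynomial.prime_of_degree_eq_one
        (degree_sub_one_of_degree_eq_one hl)) _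
    · rw [hs]
      exact dvd_pow_self _ hk
  · rintro ⟨h1, h2, h3, h4, h5, h6⟩
    obtain ⟨k, rfl⟩ := eq_pow_of_isPowerLike hp hl h2 h3 h4 h5 h6
    have hk : 0 < k := Nat.pos_of_ne_zero fun h => h1 (by rw [h, pow_zero, pow_one])
    exact ⟨⟨k, hk⟩, rfl⟩

/-- By Frobenius, `(l ^ p ^ k - l) ^ p ^ a = l ^ p ^ (a + k) - l ^ p ^ a`, so exponents may be
reduced modulo `k`; a degree count then separates the residues. -/
theorem pow_modEq_iff (hp : p.Prime) {l : R[X]} (hl : l.degree = 1) {k : ℕ} (hk : 0 < k)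
    (m n : ℕ) : l ^ p ^ k - l ∣ l ^ p ^ m - l ^ p ^ n ↔ m ≡ n [MOD k] := by
  have : Fact p.Prime := ⟨hp⟩
  set A := l ^ p ^ k - l with hA
  have hstep : ∀ a, A ∣ l ^ p ^ (a + k) - l ^ p ^ a := fun a => by
    have : l ^ p ^ (a + k) - l ^ p ^ a = A ^ p ^ a := by
      rw [hA, sub_pow_char_pow, ← pow_mul, ← pow_add, add_comm]
    rw [this]
    exact dvd_pow_self _ (pow_ne_zero _ hp.ne_zero)
  have hmul : ∀ q a, A ∣ l ^ p ^ (a + k * q) - l ^ p ^ a := fun q a => by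
    induction q with
    | zero => simp
    | succ q ih =>
      have := dvd_add (hstep (a + k * q)) ih
      rwa [sub_add_sub_cancel, add_assoc, ← Nat.mul_succ] at this
  have hmod : ∀ a, A ∣ l ^ p ^ a - l ^ p ^ (a % k) := fun a => by
    have := hmul (a / k) (a % k)
    rwa [Nat.mod_add_div] at this
  have hred : A ∣ l ^ p ^ m - l ^ p ^ n ↔ A ∣ l ^ p ^ (m % k) - l ^ p ^ (n % k) := by
    have h : l ^ p ^ m - l ^ p ^ n = (l ^ p ^ (m % k) - l ^ p ^ (n % k)) +
        ((l ^ p ^ m - l ^ p ^ (m % k)) - (l ^ p ^ n - l ^ p ^ (n % k))) := by ring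
    rw [h]
    exact dvd_add_left (dvd_sub (hmod m) (hmod n))
  rw [hred]
  constructor
  · intro h
    have hdeg : ∀ a, (l ^ p ^ (a % k)).natDegree < p ^ k := fun a => by
      rw [natDegree_pow_of_degree_eq_one hl]
      exact Nat.pow_lt_pow_right hp.one_lt (Nat.mod_lt _ hk)
    have hAd : A.natDegree = p ^ k := by
      rw [hA, natDegree_sub_eq_left_of_natDegree_lt, natDegree_pow_of_degree_eq_one hl]
      rw [natDegree_pow_of_degree_eq_one hl, natDegree_eq_of_degree_eq_some hl]
      exact Nat.one_lt_pow hk.ne' hp.one_lt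
    -- Both reduced powers have degree below `p ^ k`, the degree of `A`, so their difference is
    -- zero.
    have h0 := eq_zero_of_dvd_of_natDegree_lt h
      (by rw [hAd]; exact (natDegree_sub_le _ _).trans_lt (max_lt (hdeg m) (hdeg n)))
    exact Nat.pow_right_injective hp.two_le (pow_inj_of_degree_eq_one hl hl (sub_eq_zero.1 h0))
  · intro h
    rw [show m % k = n % k from h, sub_self]
    exact dvd_zero _

/-- Any two linear polynomials differ by an affine substitution, whose coefficients Frobenius raises
to the power `p ^ m`. Conversely, an affine relation preserves the degree, which determines the
exponent. -/
theorem exists_eq_const_mul_add_iff (hp : p.Prime) {l l' : R[X]} (hl : l.degree = 1)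
    (hl' : l'.degree = 1) (m n : ℕ) :
    (∃ a b : R[X], (a = 0 ∨ IsUnit a) ∧ (b = 0 ∨ IsUnit b) ∧
      l' ^ p ^ n = a * l ^ p ^ m + b) ↔ m = n := by
  have : Fact p.Prime := ⟨hp⟩
  simp only [eq_zero_or_isUnit_iff_exists_C]
  constructor
  · rintro ⟨_, _, ⟨r, rfl⟩, ⟨s, rfl⟩, h⟩
    have h1 := congrArg natDegree h
    rw [natDegree_pow_of_degree_eq_one hl', natDegree_add_C] at h1
    have hr : r ≠ 0 := by
      rintro rfl
      rw [C_0, zero_mul, natDegree_zero] at h1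
      exact pow_ne_zero _ hp.ne_zero h1
    rw [natDegree_C_mul hr, natDegree_pow_of_degree_eq_one hl] at h1
    exact (Nat.pow_right_injective hp.two_le h1).symm
  · rintro rfl
    have h := Polynomial.eq_X_add_C_of_degree_le_one hl.le
    have h' := Polynomial.eq_X_add_C_of_degree_le_one hl'.le
    have ha : l.coeff 1 ≠ 0 := Polynomial.coeff_ne_zero_of_eq_degree hl
    have hlin : l' = C (l'.coeff 1 / l.coeff 1) * l +
        C (l'.coeff 0 - l'.coeff 1 / l.coeff 1 * l.coeff 0) := by
      conv_lhs => rw [h']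
      conv_rhs => rw [h]
      simp only [coeff_add, coeff_C_mul, coeff_X_one, coeff_C_zero, coeff_C_succ, coeff_X_zero,
        mul_one, add_zero, mul_zero, zero_add]
      rw [mul_add, ← mul_assoc, ← C_mul, div_mul_cancel₀ _ ha, C_sub, C_mul]
      ring
    refine ⟨_, _, ⟨(l'.coeff 1 / l.coeff 1) ^ p ^ m, rfl⟩,
      ⟨(l'.coeff 0 - l'.coeff 1 / l.coeff 1 * l.coeff 0) ^ p ^ m, rfl⟩, ?_⟩
    conv_lhs => rw [hlin]
    rw [add_pow_char_pow, mul_pow, C_pow, C_pow]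

end Algebra

/-! ### Uniform definability of the relations between exponents. -/

/-- The class of fields of positive characteristic. -/
structure PosCharField : Type (u + 1) where
  /-- the field -/
  R : Type u
  [field : Field R]
  /-- the characteristic -/
  p : ℕ
  [charP : CharP R p]
  pos : 0 < p

namespace PosCharField

open Polynomial

attribute [instance] PosCharField.field PosCharField.charP

theorem prime (K : PosCharField.{u}) : K.p.Prime :=
  (CharP.char_is_prime_or_zero K.R K.p).resolve_right K.pos.ne'

/-- The polynomial `f` represents the exponent `n` if it is the `p ^ n`-th power of a linear
polynomial. -/
def Represents (K : PosCharField.{u}) (f : K.R[X]) (n : ℕ+) : Prop :=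
  ∃ l : K.R[X], l.degree = 1 ∧ f = l ^ K.p ^ (n : ℕ)

theorem Represents.unique {K : PosCharField.{u}} {f : K.R[X]} {m n : ℕ+}
    (hm : K.Represents f m) (hn : K.Represents f n) : m = n := by
  obtain ⟨l, hl, rfl⟩ := hm
  obtain ⟨l', hl', h⟩ := hn
  exact PNat.coe_injective
    (Nat.pow_right_injective K.prime.two_le (pow_inj_of_degree_eq_one hl hl' h))

theorem represents_X_pow (K : PosCharField.{u}) (n : ℕ+) :
    K.Represents (X ^ K.p ^ (n : ℕ)) n :=
  ⟨X, degree_X, rfl⟩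

/-- Uniform definability in the polynomial rings over fields of positive characteristic. -/
noncomputable abbrev polynomialDefinability : DefinabilitySystem fun K : PosCharField.{u} => K.R[X] :=
  uniformDefinability _

section

open DefinabilitySystem uniformDefinability

variable {α : Type} {r s t : ∀ K : PosCharField.{u}, (α → K.R[X]) → K.R[X]}

theorem def_const (hs : polynomialDefinability.Fun s) :
    polynomialDefinability.Def fun K v => s K v = 0 ∨ IsUnit (s K v) :=
  or (eq hs zero) (isUnit hs)

theorem def_degree_eq_one (hs : polynomialDefinability.Fun s) :
    polynomialDefinability.Def fun K v => (s K v).degree = 1 :=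
  congr (DefinabilitySystem.and _ (DefinabilitySystem.not _ (isUnit hs))
    (all (P := fun K v f => ∃ c : K.R[X], (c = 0 ∨ IsUnit c) ∧ s K v ∣ f - c)
      (DefinabilitySystem.ex _
        (P := fun K w c => (c = 0 ∨ IsUnit c) ∧ s K (fun a => w (some a)) ∣ w none - c)
        (DefinabilitySystem.and _ (def_const (var none))
          (dvd hs.wk.wk (sub (var (some none)) (var none)))))))
    fun _ _ => degree_eq_one_iff_forall_dvd_sub.symm

/-- The polynomial `f` is the `p ^ k`-th power of the linear polynomial `l` for a positive `k`. -/
def IsLinearPow (K : PosCharField.{u}) (l f : K.R[X]) : Prop :=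
  l.degree = 1 ∧ ∃ k : ℕ+, f = l ^ K.p ^ (k : ℕ)

theorem def_isLinearPow (hs : polynomialDefinability.Fun s) (ht : polynomialDefinability.Fun t) :
    polynomialDefinability.Def fun K v => K.IsLinearPow (s K v) (t K v) :=
  congr (DefinabilitySystem.and _ (def_degree_eq_one hs) <|
    DefinabilitySystem.and _ (DefinabilitySystem.not _ (eq ht hs)) <|
    DefinabilitySystem.and _ (DefinabilitySystem.not _ (eq ht zero)) <|
    DefinabilitySystem.and _ (DefinabilitySystem.not _ (isUnit ht)) <|
    DefinabilitySystem.and _ (isPowerLike hs ht) <|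
    DefinabilitySystem.and _ (isPowerLike (sub hs one) (sub ht one))
      (dvd (sub hs one) (sub ht one)))
    fun K _ => and_congr_right fun hl => (exists_eq_pow_iff K.prime hl).symm

/-- The polynomial `g` is an affine function of `f`. -/
def IsAffine (K : PosCharField.{u}) (f g : K.R[X]) : Prop :=
  ∃ a b : K.R[X], (a = 0 ∨ IsUnit a) ∧ (b = 0 ∨ IsUnit b) ∧ g = a * f + b

theorem def_isAffine (hs : polynomialDefinability.Fun s) (ht : polynomialDefinability.Fun t) :
    polynomialDefinability.Def fun K v => K.IsAffine (s K v) (t K v) :=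
  DefinabilitySystem.ex _ (P := fun K v a => ∃ b : K.R[X], (a = 0 ∨ IsUnit a) ∧
      (b = 0 ∨ IsUnit b) ∧ t K v = a * s K v + b) <|
    DefinabilitySystem.ex _ (P := fun K w b => (w none = 0 ∨ IsUnit (w none)) ∧
      (b = 0 ∨ IsUnit b) ∧
        t K (fun a => w (some a)) = w none * s K (fun a => w (some a)) + b) <|
    DefinabilitySystem.and _ (def_const (var (some none))) <|
    DefinabilitySystem.and _ (def_const (var none))
      (eq ht.wk.wk (add (mul (var (some none)) hs.wk.wk) (var none)))

theorem isAffine_iff {K : PosCharField.{u}} {f g : K.R[X]} {m n : ℕ+} (hf : K.Represents f m)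
    (hg : K.Represents g n) : K.IsAffine f g ↔ m = n := by
  obtain ⟨l, hl, rfl⟩ := hf
  obtain ⟨l', hl', rfl⟩ := hg
  exact (exists_eq_const_mul_add_iff K.prime hl hl' m n).trans PNat.coe_inj

/-- The power `h` of the linear polynomial `l` has the same exponent as `f`. -/
def IsConjugate (K : PosCharField.{u}) (l f h : K.R[X]) : Prop :=
  K.IsLinearPow l h ∧ K.IsAffine f h

theorem def_isConjugate (hr : polynomialDefinability.Fun r) (hs : polynomialDefinability.Fun s)
    (ht : polynomialDefinability.Fun t) :
    polynomialDefinability.Def fun K v => K.IsConjugate (r K v) (s K v) (t K v) :=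
  DefinabilitySystem.and _ (def_isLinearPow hr ht) (def_isAffine hs ht)

/-- This moves an exponent to a prescribed base: two codes can be compared by divisibility only
after both are rewritten over the same `l`. -/
theorem isConjugate_iff {K : PosCharField.{u}} {l f h : K.R[X]} {n : ℕ+} (hl : l.degree = 1)
    (hf : K.Represents f n) : K.IsConjugate l f h ↔ h = l ^ K.p ^ (n : ℕ) := by
  constructor
  · rintro ⟨⟨-, k, rfl⟩, h⟩
    rw [(isAffine_iff hf ⟨l, hl, rfl⟩).1 h]
  · rintro rfl
    exact ⟨⟨hl, n, rfl⟩, (isAffine_iff hf ⟨l, hl, rfl⟩).2 rfl⟩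

/-- The order of the exponents. -/
def ExponentLE (K : PosCharField.{u}) (f g : K.R[X]) : Prop :=
  ∃ l a b : K.R[X], K.IsConjugate l f a ∧ K.IsConjugate l g b ∧ a ∣ b

/-- Congruence of the exponents of `f` and `g` modulo the exponent of `h`. -/
def ExponentModEq (K : PosCharField.{u}) (f g h : K.R[X]) : Prop :=
  ∃ l a b c : K.R[X], K.IsConjugate l f a ∧ K.IsConjugate l g b ∧ K.IsConjugate l h c ∧
    c - l ∣ a - b

/-- Divisibility of the exponents. -/
def ExponentDvd (K : PosCharField.{u}) (f g : K.R[X]) : Prop :=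
  ∃ l a b : K.R[X], K.IsConjugate l f a ∧ K.IsConjugate l g b ∧ a - l ∣ b - l

theorem def_exponentLE (hs : polynomialDefinability.Fun s) (ht : polynomialDefinability.Fun t) :
    polynomialDefinability.Def fun K v => K.ExponentLE (s K v) (t K v) := by
  unfold ExponentLE
  apply DefinabilitySystem.ex
  apply DefinabilitySystem.ex
  apply DefinabilitySystem.ex
  exact DefinabilitySystem.and _ (def_isConjugate (var _) hs.wk.wk.wk (var _)) <|
    DefinabilitySystem.and _ (def_isConjugate (var _) ht.wk.wk.wk (var _)) (dvd (var _) (var _))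

theorem def_exponentModEq (hr : polynomialDefinability.Fun r) (hs : polynomialDefinability.Fun s)
    (ht : polynomialDefinability.Fun t) :
    polynomialDefinability.Def fun K v => K.ExponentModEq (r K v) (s K v) (t K v) := by
  unfold ExponentModEq
  apply DefinabilitySystem.ex
  apply DefinabilitySystem.ex
  apply DefinabilitySystem.ex
  apply DefinabilitySystem.ex
  exact DefinabilitySystem.and _ (def_isConjugate (var _) hr.wk.wk.wk.wk (var _)) <|
    DefinabilitySystem.and _ (def_isConjugate (var _) hs.wk.wk.wk.wk (var _)) <|
    DefinabilitySystem.and _ (def_isConjugate (var _) ht.wk.wk.wk.wk (var _))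
      (dvd (sub (var _) (var _)) (sub (var _) (var _)))

theorem def_exponentDvd (hs : polynomialDefinability.Fun s) (ht : polynomialDefinability.Fun t) :
    polynomialDefinability.Def fun K v => K.ExponentDvd (s K v) (t K v) := by
  unfold ExponentDvd
  apply DefinabilitySystem.ex
  apply DefinabilitySystem.ex
  apply DefinabilitySystem.ex
  exact DefinabilitySystem.and _ (def_isConjugate (var _) hs.wk.wk.wk (var _)) <|
    DefinabilitySystem.and _ (def_isConjugate (var _) ht.wk.wk.wk (var _))
      (dvd (sub (var _) (var _)) (sub (var _) (var _)))

variable {K : PosCharField.{u}} {f g h : K.R[X]} {m n k : ℕ+}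

theorem exponentLE_iff (hf : K.Represents f m) (hg : K.Represents g n) :
    K.ExponentLE f g ↔ m ≤ n := by
  rw [← PNat.coe_le_coe]
  constructor
  · rintro ⟨l, a, b, ha, hb, hd⟩
    have hl := ha.1.1
    rw [(isConjugate_iff hl hf).1 ha, (isConjugate_iff hl hg).1 hb] at hd
    exact (pow_dvd_pow_iff_of_degree_eq_one K.prime hl _ _).1 hd
  · intro hmn
    exact ⟨X, _, _, (isConjugate_iff degree_X hf).2 rfl, (isConjugate_iff degree_X hg).2 rfl,
      (pow_dvd_pow_iff_of_degree_eq_one K.prime degree_X _ _).2 hmn⟩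

theorem exponentModEq_iff (hf : K.Represents f m) (hg : K.Represents g n)
    (hh : K.Represents h k) : K.ExponentModEq f g h ↔ (m : ℕ) ≡ n [MOD k] := by
  constructor
  · rintro ⟨l, a, b, c, ha, hb, hc, hd⟩
    have hl := ha.1.1
    rw [(isConjugate_iff hl hf).1 ha, (isConjugate_iff hl hg).1 hb,
      (isConjugate_iff hl hh).1 hc] at hd
    exact (pow_modEq_iff K.prime hl k.pos _ _).1 hd
  · intro hmn
    exact ⟨X, _, _, _, (isConjugate_iff degree_X hf).2 rfl, (isConjugate_iff degree_X hg).2 rfl,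
      (isConjugate_iff degree_X hh).2 rfl, (pow_modEq_iff K.prime degree_X k.pos _ _).2 hmn⟩

theorem exponentDvd_iff (hf : K.Represents f m) (hg : K.Represents g n) :
    K.ExponentDvd f g ↔ m ∣ n := by
  have key : ∀ {l : K.R[X]}, l.degree = 1 →
      (l ^ K.p ^ (m : ℕ) - l ∣ l ^ K.p ^ (n : ℕ) - l ↔ m ∣ n) := fun {l} hl => by
    -- The polynomial `l` itself is `l ^ p ^ 0`, so divisibility by `m` is congruence to `0` modulo
    -- `m`.
    have := pow_modEq_iff K.prime hl m.pos n 0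
    rw [pow_zero, pow_one] at this
    rw [this, Nat.modEq_zero_iff_dvd, PNat.dvd_iff]
  constructor
  · rintro ⟨l, a, b, ha, hb, hd⟩
    have hl := ha.1.1
    rw [(isConjugate_iff hl hf).1 ha, (isConjugate_iff hl hg).1 hb] at hd
    exact (key hl).1 hd
  · intro hmn
    exact ⟨X, _, _, (isConjugate_iff degree_X hf).2 rfl, (isConjugate_iff degree_X hg).2 rfl,
      (key degree_X).2 hmn⟩

/-- The polynomial `f` represents some exponent. -/
def IsRepresentative (K : PosCharField.{u}) (f : K.R[X]) : Prop :=
  ∃ l, K.IsLinearPow l f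

theorem isRepresentative_iff : K.IsRepresentative f ↔ ∃ n, K.Represents f n :=
  ⟨fun ⟨l, hl, n, h⟩ => ⟨n, l, hl, h⟩, fun ⟨n, l, hl, h⟩ => ⟨l, hl, n, h⟩⟩

theorem def_isRepresentative (hs : polynomialDefinability.Fun s) :
    polynomialDefinability.Def fun K v => K.IsRepresentative (s K v) := by
  unfold IsRepresentative
  apply DefinabilitySystem.ex
  exact def_isLinearPow (var _) hs.wk

end

/-! ### Arithmetic of positive integers through their codes. -/

/-- Relations on the positive integers which are uniformly definable in terms of
representatives. -/
def exponentDefinability : DefinabilitySystem fun _ : Unit => ℕ+ where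
  Def {α} Q := ∃ P : ∀ K : PosCharField.{u}, (α → K.R[X]) → Prop, polynomialDefinability.Def P ∧
    ∀ K v n, (∀ a, K.Represents (v a) (n a)) → (P K v ↔ Q () n)
  -- An exponent has many codes, so equality of exponents is affine equivalence of codes.
  eq_var a b := ⟨_, def_isAffine (DefinabilitySystem.var a) (DefinabilitySystem.var b),
    fun _ _ _ h => isAffine_iff (h a) (h b)⟩
  not := fun ⟨P, hP, h⟩ => ⟨_, DefinabilitySystem.not _ hP, fun K v n hv => not_congr (h K v n hv)⟩
  and := fun ⟨P, hP, h⟩ ⟨P', hP', h'⟩ => ⟨_, DefinabilitySystem.and _ hP hP',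
    fun K v n hv => and_congr (h K v n hv) (h' K v n hv)⟩
  ex := fun {α Q} ⟨P, hP, h⟩ => by
    -- The quantifier is relativised to codes; the code `X ^ p ^ k` shows that no exponent is lost.
    refine ⟨_, DefinabilitySystem.ex _
      (P := fun K v y => K.IsRepresentative y ∧ P K fun o => o.elim y v)
      (DefinabilitySystem.and _ (def_isRepresentative (DefinabilitySystem.var none))
        (DefinabilitySystem.congr hP fun K w => ?_)), fun K v n hv => ?_⟩
    · exact iff_of_eq (congrArg (P K) (funext fun o => by cases o <;> rfl))
    · have key : ∀ y k, K.Represents y k → ((P K fun o => o.elim y v) ↔ Q () n k) :=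
        fun y k hy => h K (fun o => o.elim y v) (fun o => o.elim k n) fun a => by
          cases a
          · exact hy
          · exact hv _
      constructor
      · rintro ⟨y, hy, hP⟩
        obtain ⟨k, hk⟩ := isRepresentative_iff.1 hy
        exact ⟨k, (key y k hk).1 hP⟩
      · rintro ⟨k, hk⟩
        have hr := K.represents_X_pow k
        exact ⟨_, isRepresentative_iff.2 ⟨k, hr⟩, (key _ k hr).2 hk⟩
  relabel g := fun ⟨P, hP, h⟩ => ⟨_, DefinabilitySystem.relabel _ g hP,
    fun K v n hv => h K _ _ fun a => hv (g a)⟩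

namespace exponentDefinability

open DefinabilitySystem

variable {α : Type} {r s t : Unit → (α → ℕ+) → ℕ+}

theorem le (hs : exponentDefinability.{u}.Fun s) (ht : exponentDefinability.{u}.Fun t) :
    exponentDefinability.{u}.Def fun i v => s i v ≤ t i v :=
  bind₂ (Q := fun _ x y => x ≤ y)
    ⟨_, def_exponentLE (var 0) (var 1), fun _ _ _ h => exponentLE_iff (h 0) (h 1)⟩ hs ht

theorem modEq (hr : exponentDefinability.{u}.Fun r) (hs : exponentDefinability.{u}.Fun s)
    (ht : exponentDefinability.{u}.Fun t) :
    exponentDefinability.{u}.Def fun i v => (r i v : ℕ) ≡ s i v [MOD t i v] :=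
  bind₃ (Q := fun _ (x y z : ℕ+) => (x : ℕ) ≡ y [MOD z])
    ⟨_, def_exponentModEq (var 0) (var 1) (var 2),
      fun _ _ _ h => exponentModEq_iff (h 0) (h 1) (h 2)⟩ hr hs ht

theorem dvd (hs : exponentDefinability.{u}.Fun s) (ht : exponentDefinability.{u}.Fun t) :
    exponentDefinability.{u}.Def fun i v => s i v ∣ t i v :=
  bind₂ (Q := fun _ x y => x ∣ y)
    ⟨_, def_exponentDvd (var 0) (var 1), fun _ _ _ h => exponentDvd_iff (h 0) (h 1)⟩ hs ht

/-- The sum `a + b` is the least number above `a` congruent to `a` modulo `b`. -/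
theorem eq_add_iff {a b c : ℕ+} :
    c = a + b ↔ ¬ c ≤ a ∧ (c : ℕ) ≡ a [MOD b] ∧ ∀ d : ℕ+, ¬ d ≤ a → (d : ℕ) ≡ a [MOD b] → c ≤ d := by
  have key : ∀ d : ℕ+, ¬ d ≤ a → (d : ℕ) ≡ a [MOD b] → a + b ≤ d := fun d hd h => by
    have hd' : (a : ℕ) < d := by simpa using hd
    have := Nat.le_of_dvd (Nat.sub_pos_of_lt hd') ((Nat.modEq_iff_dvd' hd'.le).1 h.symm)
    rw [← PNat.coe_le_coe, PNat.add_coe]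
    omega
  have hab : ¬ a + b ≤ a := not_le.2 (PNat.lt_add_right a b)
  have hmod : ((a + b : ℕ+) : ℕ) ≡ a [MOD b] := by
    rw [PNat.add_coe]
    exact Nat.add_modEq_right
  constructor
  · rintro rfl
    exact ⟨hab, hmod, key⟩
  · rintro ⟨h1, h2, h3⟩
    exact le_antisymm (h3 _ hab hmod) (key c h1 h2)

theorem add (hs : exponentDefinability.{u}.Fun s) (ht : exponentDefinability.{u}.Fun t) :
    exponentDefinability.{u}.Fun fun i v => s i v + t i v :=
  comp₂ (f := fun _ x y => x + y) (congr (by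
    apply DefinabilitySystem.and _ (DefinabilitySystem.not _ (le (var 0) (var 1)))
    apply DefinabilitySystem.and _ (modEq (var 0) (var 1) (var 2))
    apply all (P := fun _ v (d : ℕ+) => ¬ d ≤ v 1 → (d : ℕ) ≡ v 1 [MOD v 2] → v 0 ≤ d)
    exact imp (DefinabilitySystem.not _ (le (var none) (var (some 1)))) <|
      imp (modEq (var none) (var (some 1)) (var (some 2))) (le (var (some 0)) (var none)))
    fun _ _ => eq_add_iff.symm) hs ht

theorem one : exponentDefinability.{u}.Fun (α := α) fun _ _ => 1 :=
  congr (all (P := fun _ w y => w none ≤ y) (le (var (some none)) (var none)))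
    fun _ _ => ⟨fun h => le_antisymm (h 1) (one_le), fun h _ => h ▸ one_le⟩

/-- As `a` and `a + 1` are coprime, their least common multiple is `a * (a + 1) = a * a + a`. -/
theorem eq_sq_iff {a b : ℕ+} :
    b = a * a ↔ a ∣ b + a ∧ a + 1 ∣ b + a ∧ ∀ d, a ∣ d → a + 1 ∣ d → b + a ≤ d := by
  have hsq : a * a + a = a * (a + 1) := by rw [mul_add, mul_one]
  have key : ∀ d, a ∣ d → a + 1 ∣ d → a * (a + 1) ≤ d := fun d h1 h2 => by
    rw [PNat.dvd_iff] at h1 h2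
    rw [← PNat.coe_le_coe, PNat.mul_coe]
    refine Nat.le_of_dvd d.pos (Nat.Coprime.mul_dvd_of_dvd_of_dvd ?_ h1 h2)
    rw [PNat.add_coe, PNat.one_coe]
    exact (Nat.coprime_self_add_right).2 (Nat.coprime_one_right _)
  constructor
  · rintro rfl
    rw [hsq]
    exact ⟨dvd_mul_right _ _, dvd_mul_left _ _, key⟩
  · rintro ⟨h1, h2, h3⟩
    have h4 := le_antisymm (h3 _ (dvd_mul_right a (a + 1)) (dvd_mul_left _ _)) (key _ h1 h2)
    rw [← hsq] at h4
    exact add_right_cancel h4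

theorem def_eq_sq (hs : exponentDefinability.{u}.Fun s) (ht : exponentDefinability.{u}.Fun t) :
    exponentDefinability.{u}.Def fun i v => s i v = t i v * t i v :=
  congr (DefinabilitySystem.and _ (dvd ht (add hs ht)) <|
    DefinabilitySystem.and _ (dvd (add ht one) (add hs ht)) <|
    all (P := fun i v d => t i v ∣ d → t i v + 1 ∣ d → s i v + t i v ≤ d) <|
      imp (dvd ht.wk (var none)) <| imp (dvd (add ht.wk one) (var none))
        (le (add hs.wk ht.wk) (var none)))
    fun _ _ => eq_sq_iff.symm

theorem sq (ht : exponentDefinability.{u}.Fun t) :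
    exponentDefinability.{u}.Fun fun i v => t i v * t i v :=
  def_eq_sq (var none) ht.wk

/-- Polarisation: the cross term of `(a + b) * (a + b)` recovers the product from squares. -/
theorem eq_mul_iff {a b c : ℕ+} :
    c = a * b ↔ (a + b) * (a + b) = a * a + b * b + c + c := by
  rw [← PNat.coe_inj, ← PNat.coe_inj]
  push_cast
  constructor <;> intro h <;> nlinarith

theorem mul (hs : exponentDefinability.{u}.Fun s) (ht : exponentDefinability.{u}.Fun t) :
    exponentDefinability.{u}.Fun fun i v => s i v * t i v :=
  congr (eq (sq (add hs.wk ht.wk))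
    (add (add (add (sq hs.wk) (sq ht.wk)) (var none)) (var none))) fun _ _ => eq_mul_iff.symm

end exponentDefinability

/-! ### The two interpretations. -/

open DefinabilitySystem

/-- Pairs `(l, l ^ p ^ k)` interpret the positive integers with their order and divisibility. -/
theorem exists_interpretation_leDvd :
    ∃ Γ : InterpretationFormulas 2 leDvdLanguage addMulLanguage, ∀ K : PosCharField.{u},
      Γ.domainSet K.R[X] =
        {a | ∃ (l : K.R[X]) (k : ℕ+), l.degree = 1 ∧ a = ![l, l ^ (K.p ^ (k : ℕ))]} ∧
      ∃ F : Γ.CoordinateMap K.R[X] ℕ+,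
        ∀ (l : K.R[X]) (k : ℕ+) (h : ![l, l ^ (K.p ^ (k : ℕ))] ∈ Γ.domainSet K.R[X]),
          l.degree = 1 → F.toFun ⟨![l, l ^ (K.p ^ (k : ℕ))], h⟩ = k := by
  obtain ⟨φ, hφ⟩ := def_isLinearPow.{u} (var (0 : Fin 2)) (var 1)
  obtain ⟨φe, hφe⟩ := def_isAffine.{u} (var ((0, 1) : Fin 2 × Fin 2)) (var (1, 1))
  obtain ⟨φl, hφl⟩ := def_exponentLE.{u} (var ((0, 1) : Fin 2 × Fin 2)) (var (1, 1))
  obtain ⟨φv, hφv⟩ := def_exponentDvd.{u} (var ((0, 1) : Fin 2 × Fin 2)) (var (1, 1))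
  let Γ : InterpretationFormulas 2 leDvdLanguage addMulLanguage :=
    { domain := φ
      eq := φe
      rel := fun {m} (r : LeDvdRel m) => match m, r with
        | _, .le => φl
        | _, .dvd => φv
      func := fun f => f.elim }
  refine ⟨Γ, fun K => ?_⟩
  have hdom : ∀ a : Fin 2 → K.R[X], a ∈ Γ.domainSet K.R[X] ↔ K.IsLinearPow (a 0) (a 1) := hφ K
  have hex : ∀ a : Γ.domainSet K.R[X], ∃ k : ℕ+, K.Represents (a.1 1) k := fun a => by
    obtain ⟨hl, k, h⟩ := (hdom a.1).1 a.2
    exact ⟨k, a.1 0, hl, h⟩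
  choose val hval using hex
  have hval' : ∀ (l : K.R[X]) (k : ℕ+) (h : ![l, l ^ (K.p ^ (k : ℕ))] ∈ Γ.domainSet K.R[X]),
      l.degree = 1 → val ⟨![l, l ^ (K.p ^ (k : ℕ))], h⟩ = k :=
    fun l k h hl => (hval ⟨_, h⟩).unique ⟨l, hl, rfl⟩
  refine ⟨Set.ext fun a => (hdom a).trans ⟨?_, ?_⟩, ⟨val, ?_, ?_, ?_, ?_⟩, hval'⟩
  · rintro ⟨hl, k, h⟩
    refine ⟨a 0, k, hl, funext fun i => ?_⟩
    fin_cases i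
    · rfl
    · exact h
  · rintro ⟨l, k, hl, rfl⟩
    exact ⟨hl, k, rfl⟩
  · exact fun k => ⟨⟨_, (hdom ![X, X ^ (K.p ^ (k : ℕ))]).2 ⟨degree_X, k, rfl⟩⟩,
      hval' _ _ _ degree_X⟩
  · exact fun a b => (hφe K _).trans (isAffine_iff (hval a) (hval b))
  · intro m Q a
    match m, Q, a with
    | _, .le, a => exact (hφl K _).trans (exponentLE_iff (hval (a 0)) (hval (a 1)))
    | _, .dvd, a => exact (hφv K _).trans (exponentDvd_iff (hval (a 0)) (hval (a 1)))
  · exact fun G => G.elim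

/-- Differences of exponents interpret the ring of integers. -/
theorem exists_interpretation_int :
    ∃ Γ : InterpretationFormulas 2 addMulLanguage addMulLanguage, ∀ K : PosCharField.{u},
      Nonempty (Γ.CoordinateMap K.R[X] ℤ) := by
  obtain ⟨φ, hφ⟩ := DefinabilitySystem.and _ (def_isRepresentative.{u} (var (0 : Fin 2)))
    (def_isRepresentative (var 1))
  -- A pair of codes with exponents `a` and `b` stands for `a - b`; equality, sum and product are
  -- stated with negative terms moved across, so that only positive integers occur.
  obtain ⟨Pe, ⟨φe, hφe⟩, hPe⟩ := eq
    (exponentDefinability.add.{u} (var ((0, 0) : Fin 2 × Fin 2)) (var (1, 1)))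
    (exponentDefinability.add (var (1, 0)) (var (0, 1)))
  obtain ⟨Pa, ⟨φa, hφa⟩, hPa⟩ := eq
    (exponentDefinability.add.{u} (exponentDefinability.add
      (var ((0, 0) : Fin 3 × Fin 2)) (var (1, 0))) (var (2, 1)))
    (exponentDefinability.add (exponentDefinability.add (var (0, 1)) (var (1, 1))) (var (2, 0)))
  obtain ⟨Pm, ⟨φm, hφm⟩, hPm⟩ := eq
    (exponentDefinability.add.{u} (exponentDefinability.add
      (exponentDefinability.mul (var ((0, 0) : Fin 3 × Fin 2)) (var (1, 0)))
      (exponentDefinability.mul (var (0, 1)) (var (1, 1)))) (var (2, 1)))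
    (exponentDefinability.add (exponentDefinability.add
      (exponentDefinability.mul (var (0, 0)) (var (1, 1)))
      (exponentDefinability.mul (var (0, 1)) (var (1, 0)))) (var (2, 0)))
  let Γ : InterpretationFormulas 2 addMulLanguage addMulLanguage :=
    { domain := φ
      eq := φe
      rel := fun r => r.elim
      func := fun {m} (f : AddMulFunc m) => match m, f with
        | _, .add => φa
        | _, .mul => φm }
  refine ⟨Γ, fun K => ?_⟩
  have hdom : ∀ a : Fin 2 → K.R[X],
      a ∈ Γ.domainSet K.R[X] ↔ K.IsRepresentative (a 0) ∧ K.IsRepresentative (a 1) := hφ K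
  have hex : ∀ (a : Γ.domainSet K.R[X]) (i : Fin 2), ∃ k : ℕ+, K.Represents (a.1 i) k :=
    fun a i => by
      have h := (hdom a.1).1 a.2
      fin_cases i
      · exact isRepresentative_iff.1 h.1
      · exact isRepresentative_iff.1 h.2
  choose val hval using hex
  refine ⟨⟨fun a => (val a 0 : ℤ) - val a 1, ?_, ?_, fun Q => Q.elim, ?_⟩⟩
  · intro z
    obtain ⟨m, n, h⟩ : ∃ m n : ℕ+, (m : ℤ) - n = z := by
      -- The shift `k = (k + 1) - 1` keeps both exponents positive, even for `z = 0`.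
      rcases Int.eq_nat_or_neg z with ⟨k, rfl | rfl⟩
      · exact ⟨k.succPNat, 1, by simp⟩
      · exact ⟨1, k.succPNat, by simp⟩
    have hm := K.represents_X_pow m
    have hn := K.represents_X_pow n
    have hmem : ![X ^ K.p ^ (m : ℕ), X ^ K.p ^ (n : ℕ)] ∈ Γ.domainSet K.R[X] :=
      (hdom _).2 ⟨isRepresentative_iff.2 ⟨m, hm⟩, isRepresentative_iff.2 ⟨n, hn⟩⟩
    have h0 : val ⟨_, hmem⟩ 0 = m := (hval ⟨_, hmem⟩ 0).unique hm
    have h1 : val ⟨_, hmem⟩ 1 = n := (hval ⟨_, hmem⟩ 1).unique hn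
    exact ⟨⟨_, hmem⟩, by simp only [h0, h1, h]⟩
  · intro a b
    refine ((hφe K _).trans (hPe K _ (fun ij => val (![a, b] ij.1) ij.2) ?_)).trans ?_
    · rintro ⟨i, j⟩
      fin_cases i
      · exact hval a j
      · exact hval b j
    · simp [← PNat.coe_inj]
      omega
  · intro m G a b
    -- `Fin.snoc` appends the value tuple after the arguments, so the exponents of all entries are
    -- assembled in the same order.
    have hrep : ∀ ij : Fin (m + 1) × Fin 2,
        K.Represents ((Fin.snoc (fun i => (a i).1) b.1 : Fin (m + 1) → Fin 2 → K.R[X]) ij.1 ij.2)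
          (val ((Fin.snoc a b : Fin (m + 1) → Γ.domainSet K.R[X]) ij.1) ij.2) := by
      rintro ⟨i, j⟩
      refine Fin.lastCases ?_ (fun i => ?_) i
      · simpa using hval b j
      · simpa using hval (a i) j
    match m, G, a, hrep with
    | _, .add, a, hrep =>
      refine ((hφa K _).trans (hPa K _ _ hrep)).trans ?_
      change val (a 0) 0 + val (a 1) 0 + val b 1 = val (a 0) 1 + val (a 1) 1 + val b 0 ↔
        ((val (a 0) 0 : ℤ) - val (a 0) 1) + ((val (a 1) 0 : ℤ) - val (a 1) 1) =
          (val b 0 : ℤ) - val b 1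
      rw [← PNat.coe_inj]
      push_cast
      omega
    | _, .mul, a, hrep =>
      refine ((hφm K _).trans (hPm K _ _ hrep)).trans ?_
      change val (a 0) 0 * val (a 1) 0 + val (a 0) 1 * val (a 1) 1 + val b 1 =
          val (a 0) 0 * val (a 1) 1 + val (a 0) 1 * val (a 1) 0 + val b 0 ↔
        ((val (a 0) 0 : ℤ) - val (a 0) 1) * ((val (a 1) 0 : ℤ) - val (a 1) 1) =
          (val b 0 : ℤ) - val b 1
      rw [← PNat.coe_inj]
      zify
      constructor <;> intro h <;> linarith

end PosCharField

theorem mainTheorem2 :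
    (∃ Γ : InterpretationFormulas 2 leDvdLanguage addMulLanguage,
      ∀ (R : Type u) [Field R] (p : ℕ) [CharP R p], 0 < p →
        Γ.domainSet (Polynomial R) =
            {a | ∃ (l : Polynomial R) (k : ℕ+), l.degree = 1 ∧ a = ![l, l ^ (p ^ (k : ℕ))]} ∧
        ∃ F : Γ.CoordinateMap (Polynomial R) ℕ+,
          ∀ (l : Polynomial R) (k : ℕ+) (h : ![l, l ^ (p ^ (k : ℕ))] ∈ Γ.domainSet (Polynomial R)),
            l.degree = 1 → F.toFun ⟨![l, l ^ (p ^ (k : ℕ))], h⟩ = k) ∧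
    (∃ n : ℕ, 0 < n ∧ ∃ Γ : InterpretationFormulas n addMulLanguage addMulLanguage,
      ∀ (R : Type u) [Field R] (p : ℕ) [CharP R p], 0 < p →
        Nonempty (Γ.CoordinateMap (Polynomial R) ℤ)) := by
  obtain ⟨Γ, hΓ⟩ := PosCharField.exists_interpretation_leDvd.{u}
  obtain ⟨Γ', hΓ'⟩ := PosCharField.exists_interpretation_int.{u}
  exact ⟨⟨Γ, fun R _ p _ hp => hΓ ⟨R, p, hp⟩⟩, 2, two_pos, Γ', fun R _ p _ hp => hΓ' ⟨R, p, hp⟩⟩
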